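/- Let $n,m\ge 1$, let $1<p_1,\dots,p_m<\infty$, let $\frac1p=\frac1{p_1}+\dots+\frac1{p_m}$ (so $\frac1m<p<\infty$), and write $\vec P=(p_1,\dots,p_m)$, $p_i'=\frac{p_i}{p_i-1}$. Cubes are nondegenerate cubes in $\mathbb R^n$ with sides parallel to the axes. For $\vec g=(g_1,\dots,g_m)$ put $$\mathcal M(\vec g)(x)=\sup_{Q\ni x}\prod_{i=1}^m\frac1{|Q|}\int_Q|g_i(y)|\,dy ,$$ the supremum being over all cubes $Q$ containing $x$. Let $v$ be a measurable, a.e. nonnegative function and $w_1,\dots,w_m$ measurable, a.e. positive functions on $\mathbb R^n$ such that $\sigma_i:=w_i^{1-p_i'}$ is locally integrable for each $i$; write $\vec w=(w_1,\dots,w_m)$ and $\sigma_i(Q)=\int_Q\sigma_i\,dx$. Define $$[v,\vec w]_{S_{\vec P}}=\sup_Q\Big(\int_Q\mathcal M(\sigma_1\chi_Q,\dots,\sigma_m\chi_Q)^p\,v\,dx\Big)^{1/p}\Big(\prod_{i=1}^m\sigma_i(Q)^{1/p_i}\Big)^{-1}\in[0,\infty],$$ and say $(v,\vec w)\in S_{\vec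 P}$ if this is finite. Say $\vec w\in RH_{\vec P}$ if there is a finite constant $C>0$ such that for all cubes $Q$ $$\prod_{i=1}^m\sigma_i(Q)^{p/p_i}\le C\int_Q\prod_{i=1}^m\sigma_i^{p/p_i}\,dx ,$$ and let $[\vec w]_{RH_{\vec P}}$ be the smallest such $C$. Assume $\vec w\in RH_{\vec P}$. Then there is a finite constant $C>0$ such that $$\|\mathcal M(f_1\sigma_1,\dots,f_m\sigma_m)\|_{L^p(v)}\le C\prod_{i=1}^m\|f_i\|_{L^{p_i}(\sigma_i)}\qquad\text{for all } f_i\in L^{p_i}(\sigma_i),\ i=1,\dots,m,$$ if and only if $(v,\vec w)\in S_{\vec P}$. Moreover, if $\|\mathcal M\|\in[0,\infty]$ denotes the smallest (infimum) constant $C$ in this inequality, there is a constant $c>0$ depending only on $n$, $m$ and $\vec P$ (not on $v$, $\vec w$) such that $$[v,\vec w]_{S_{\vec P}}\le c\,\|\mathcal M\|\qquad\text{and}\qquad \|\mathcal M\|\le c\,[v,\vec w]_{S_{\vec P}}\,[\vec w]_{RH_{\vec P}}^{1/p}.$$ -/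

import Mathlib

open MeasureTheory
open scoped ENNReal NNReal

namespace MultiSawyer

/-- A (closed, nondegenerate) cube of `ℝⁿ` with sides parallel to the coordinate axes. -/
def IsCube {n : ℕ} (Q : Set (Fin n → ℝ)) : Prop :=
  ∃ (a : Fin n → ℝ) (l : ℝ), 0 < l ∧ Q = Set.Icc a (fun j => a j + l)

/-- The measure `u dx` for a nonnegative weight `u` on `ℝⁿ`. -/
noncomputable def wMeasure {n : ℕ} (u : (Fin n → ℝ) → ℝ) : Measure (Fin n → ℝ) :=
  volume.withDensity (fun x => ENNReal.ofReal (u x))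

/-- The multi(sub)linear maximal function
`𝓜(g)(x) = sup_{Q ∋ x} ∏ᵢ |Q|⁻¹ ∫_Q |gᵢ|`, with values in `[0, ∞]`. -/
noncomputable def maxFn {n m : ℕ} (g : Fin m → (Fin n → ℝ) → ℝ) (x : Fin n → ℝ) : ℝ≥0∞ :=
  ⨆ (Q : Set (Fin n → ℝ)) (_ : IsCube Q) (_ : x ∈ Q),
    ∏ i, ((volume Q)⁻¹ * ∫⁻ y in Q, ‖g i y‖ₑ)

/-- The dual weights `σᵢ = wᵢ ^ (1 - pᵢ')`, where `pᵢ' = pᵢ / (pᵢ - 1)`. -/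
noncomputable def dualWeight {n m : ℕ} (P : Fin m → ℝ) (w : Fin m → (Fin n → ℝ) → ℝ)
    (i : Fin m) (x : Fin n → ℝ) : ℝ :=
  w i x ^ (1 - (P i).conjExponent)

/-- The multilinear Sawyer constant
`sup_Q (∫_Q 𝓜(σ₁χ_Q, …, σₘχ_Q)^p v dx)^{1/p} (∏ᵢ σᵢ(Q)^{1/pᵢ})⁻¹`, in `[0, ∞]`. -/
noncomputable def sawyerConst {n m : ℕ} (P : Fin m → ℝ) (p : ℝ) (v : (Fin n → ℝ) → ℝ)
    (w : Fin m → (Fin n → ℝ) → ℝ) : ℝ≥0∞ :=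
  ⨆ (Q : Set (Fin n → ℝ)) (_ : IsCube Q),
    (∫⁻ x in Q, maxFn (fun i => Q.indicator (dualWeight P w i)) x ^ p
        * ENNReal.ofReal (v x)) ^ (1 / p)
      * (∏ i, wMeasure (dualWeight P w i) Q ^ (1 / P i))⁻¹

/-- `(v, w) ∈ S_P`. -/
def SawyerCond {n m : ℕ} (P : Fin m → ℝ) (p : ℝ) (v : (Fin n → ℝ) → ℝ)
    (w : Fin m → (Fin n → ℝ) → ℝ) : Prop :=
  sawyerConst P p v w < ∞

/-- The multiple reverse Hölder inequality with constant `C`: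
`∏ᵢ (∫_Q σᵢ)^{p/pᵢ} ≤ C ∫_Q ∏ᵢ σᵢ^{p/pᵢ}` for all cubes `Q`. -/
def RHBound {n m : ℕ} (P : Fin m → ℝ) (p : ℝ) (w : Fin m → (Fin n → ℝ) → ℝ)
    (C : ℝ≥0∞) : Prop :=
  ∀ Q : Set (Fin n → ℝ), IsCube Q →
    ∏ i, (∫⁻ x in Q, ENNReal.ofReal (dualWeight P w i x)) ^ (p / P i)
      ≤ C * ∫⁻ x in Q, ∏ i, ENNReal.ofReal (dualWeight P w i x) ^ (p / P i)

/-- `w ∈ RH_P`: the reverse Hölder inequality holds with some finite positive constant. -/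
def RHCond {n m : ℕ} (P : Fin m → ℝ) (p : ℝ) (w : Fin m → (Fin n → ℝ) → ℝ) : Prop :=
  ∃ C : ℝ, 0 < C ∧ RHBound P p w (ENNReal.ofReal C)

/-- The smallest constant in the reverse Hölder inequality. -/
noncomputable def rhConst {n m : ℕ} (P : Fin m → ℝ) (p : ℝ)
    (w : Fin m → (Fin n → ℝ) → ℝ) : ℝ≥0∞ :=
  sInf {C : ℝ≥0∞ | RHBound P p w C}

/-- The two-weight inequality with constant `C`:
`‖𝓜(f₁σ₁, …, fₘσₘ)‖_{L^p(v)} ≤ C ∏ᵢ ‖fᵢ‖_{L^{pᵢ}(σᵢ)}` for all `fᵢ ∈ L^{pᵢ}(σᵢ)`. -/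
def MaxBound {n m : ℕ} (P : Fin m → ℝ) (p : ℝ) (v : (Fin n → ℝ) → ℝ)
    (w : Fin m → (Fin n → ℝ) → ℝ) (C : ℝ≥0∞) : Prop :=
  ∀ f : Fin m → (Fin n → ℝ) → ℝ,
    (∀ i, MemLp (f i) (ENNReal.ofReal (P i)) (wMeasure (dualWeight P w i))) →
    (∫⁻ x, maxFn (fun i y => f i y * dualWeight P w i y) x ^ p
        * ENNReal.ofReal (v x)) ^ (1 / p)
      ≤ C * ∏ i, eLpNorm (f i) (ENNReal.ofReal (P i)) (wMeasure (dualWeight P w i))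

/-- The norm `‖𝓜‖`: the smallest constant in the two-weight inequality
(`∞` if it holds with no finite constant). -/
noncomputable def maxNorm {n m : ℕ} (P : Fin m → ℝ) (p : ℝ) (v : (Fin n → ℝ) → ℝ)
    (w : Fin m → (Fin n → ℝ) → ℝ) : ℝ≥0∞ :=
  sInf {C : ℝ≥0∞ | MaxBound P p v w C}

end MultiSawyer

/-! Necessity is the inequality tested on `f i = χ_Q`. For sufficiency, the one-third trick puts
every cube inside a cell, at most `6 ^ n` times larger in volume, of one of `2 ^ n` shifted dyadic
grids (`IsCube.exists_grid`). Hence `𝓜 ^ p` is bounded by a sum of `2 ^ n` dyadic maximal functions,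
also when `p < 1`, and monotone convergence reduces each of these to a finite family of cells.

For such a family, disjoint sets `E Q ⊆ Q` linearize the maximum. The product of Lebesgue averages
over `Q` factors as `∏ b i Q`, with `b i Q` the `σᵢ`-average of `|fᵢ|`, times `τ Q = ∏ σᵢ(Q)/|Q|`.
This leaves `∑ (∏ b i Q) ^ p * (τ Q ^ p * v(E Q))`. The testing condition bounds the mass `∑_{Q ⊆ R}
τ Q ^ p * v(E Q)` by a multiple of `∏ σᵢ(R) ^ (p / pᵢ)`. That product need not be additive in `R`;
the reverse Hölder condition replaces it by a multiple of `∫_R ∏ σᵢ ^ (p / pᵢ)`, which is a measure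
`ν`. The Carleson embedding (`Laminar.sum_mul_le_lintegral_finMax`) then bounds the sum by the
`ν`-integral of a maximal function, Hölder with exponents `pᵢ / p` separates the factors, and Doob's
inequality in each `L^{pᵢ}(σᵢ)` finishes (`lintegral_finMax_rpow_le`). -/

namespace MultiSawyer

/-! ### Finite laminar families: Carleson embedding, Doob's inequality, linearization. -/

section Laminar

variable {X : Type*}

/-- A family of sets any two of which are nested or disjoint. -/
def Laminar (F : Set (Set X)) : Prop :=
  ∀ Q ∈ F, ∀ R ∈ F, Q ⊆ R ∨ R ⊆ Q ∨ Disjoint Q R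

theorem Laminar.mono {F G : Set (Set X)} (hG : Laminar G) (h : F ⊆ G) : Laminar F :=
  fun Q hQ R hR => hG Q (h hQ) R (h hR)

open Classical in
/-- The maximal members of a finite laminar family. -/
theorem Laminar.exists_maximal {F : Finset (Set X)} (hF : Laminar (F : Set (Set X))) :
    ∃ G ⊆ F, (G : Set (Set X)).PairwiseDisjoint id ∧ ∀ Q ∈ F, ∃ R ∈ G, Q ⊆ R := by
  refine ⟨F.filter (fun R => Maximal (fun x => x ∈ F) R), Finset.filter_subset _ _, ?_, ?_⟩
  · intro Q hQ R hR hne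
    simp only [Finset.coe_filter, Set.mem_ofPred_eq] at hQ hR
    rcases hF Q hQ.1 R hR.1 with h | h | h
    · exact absurd (hQ.2.eq_of_le hR.1 h) hne
    · exact absurd (hR.2.eq_of_le hQ.1 h).symm hne
    · exact h
  · intro Q hQ
    obtain ⟨R, hQR, hR⟩ := F.exists_le_maximal hQ
    exact ⟨R, Finset.mem_filter.2 ⟨hR.prop, hR⟩, hQR⟩

/-- The maximal function `x ↦ max {c Q | x ∈ Q ∈ F}` of a finite family of sets. -/
noncomputable def finMax (F : Finset (Set X)) (c : Set X → ℝ≥0∞) (x : X) : ℝ≥0∞ :=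
  F.sup fun Q => Q.indicator (fun _ => c Q) x

theorem lt_finMax_iff {F : Finset (Set X)} {c : Set X → ℝ≥0∞} {x : X} {t : ℝ≥0∞} :
    t < finMax F c x ↔ ∃ Q ∈ F, t < c Q ∧ x ∈ Q := by
  unfold finMax
  rw [Finset.lt_sup_iff]
  refine exists_congr fun Q => and_congr_right fun _ => ?_
  by_cases hx : x ∈ Q <;> simp [hx]

theorem le_finMax {F : Finset (Set X)} (c : Set X → ℝ≥0∞) {x : X} {Q : Set X} (hQ : Q ∈ F)
    (hx : x ∈ Q) : c Q ≤ finMax F c x := by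
  have := Finset.le_sup (f := fun Q : Set X => Q.indicator (fun _ => c Q) x) hQ
  simp only [Set.indicator_of_mem hx] at this
  exact this

theorem finMax_le {F : Finset (Set X)} {c : Set X → ℝ≥0∞} {x : X} {b : ℝ≥0∞}
    (h : ∀ Q ∈ F, x ∈ Q → c Q ≤ b) : finMax F c x ≤ b := by
  refine Finset.sup_le fun Q hQ => ?_
  by_cases hx : x ∈ Q
  · simpa [hx] using h Q hQ hx
  · simp [hx]

theorem finMax_mono {F G : Finset (Set X)} (h : F ⊆ G) (c : Set X → ℝ≥0∞) (x : X) :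
    finMax F c x ≤ finMax G c x :=
  finMax_le fun _ hQ hx => le_finMax c (h hQ) hx

theorem finMax_lt_top {F : Finset (Set X)} {c : Set X → ℝ≥0∞} (hc : ∀ Q ∈ F, c Q < ∞) (x : X) :
    finMax F c x < ∞ := by
  refine (Finset.sup_lt_iff (by simp)).2 fun Q hQ => ?_
  by_cases hx : x ∈ Q
  · simpa [hx] using hc Q hQ
  · simp [hx]

variable [MeasurableSpace X]

theorem measurable_finMax {F : Finset (Set X)} (hF : ∀ Q ∈ F, MeasurableSet Q)
    (c : Set X → ℝ≥0∞) : Measurable (finMax F c) := by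
  have : finMax F c = F.sup fun Q => Q.indicator fun _ => c Q :=
    funext fun x => (Finset.sup_apply _ _ _).symm
  rw [this]
  exact Finset.sup_induction measurable_const (fun _ h₁ _ h₂ => h₁.sup h₂)
    fun Q hQ => measurable_const.indicator (hF Q hQ)

/-- Layer-cake formula, applied to the real function `(g x).toReal`; finiteness of `g` makes this
passage lossless. -/
theorem lintegral_rpow_eq_lintegral_meas_ofReal_lt {μ : Measure X} {g : X → ℝ≥0∞}
    (hg : Measurable g) (hfin : ∀ x, g x < ∞) {q : ℝ} (hq : 0 < q) :
    ∫⁻ x, g x ^ q ∂μ = ENNReal.ofReal q *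
      ∫⁻ t in Set.Ioi (0 : ℝ), μ {x | ENNReal.ofReal t < g x} * ENNReal.ofReal (t ^ (q - 1)) := by
  have h := lintegral_rpow_eq_lintegral_meas_lt_mul μ (f := fun x => (g x).toReal)
    (Filter.Eventually.of_forall fun x => ENNReal.toReal_nonneg) hg.ennreal_toReal.aemeasurable hq
  have h1 : ∀ x, ENNReal.ofReal ((g x).toReal ^ q) = g x ^ q := fun x => by
    rw [← ENNReal.ofReal_rpow_of_nonneg ENNReal.toReal_nonneg hq.le,
      ENNReal.ofReal_toReal (hfin x).ne]
  simp only [h1] at h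
  rw [h]
  congr 1
  refine setLIntegral_congr_fun measurableSet_Ioi fun t ht => ?_
  simp only [ENNReal.ofReal_lt_iff_lt_toReal (le_of_lt (Set.mem_Ioi.1 ht)) (hfin _).ne]

theorem lintegral_eq_lintegral_meas_ofReal_lt {μ : Measure X} {g : X → ℝ≥0∞}
    (hg : Measurable g) (hfin : ∀ x, g x < ∞) :
    ∫⁻ x, g x ∂μ = ∫⁻ t in Set.Ioi (0 : ℝ), μ {x | ENNReal.ofReal t < g x} := by
  simpa using lintegral_rpow_eq_lintegral_meas_ofReal_lt (μ := μ) hg hfin one_pos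

open Classical in
/-- The Carleson embedding for a finite laminar family. -/
theorem Laminar.sum_mul_le_lintegral_finMax {F : Finset (Set X)}
    (hF : Laminar (F : Set (Set X))) (hmeas : ∀ Q ∈ F, MeasurableSet Q)
    (μ c : Set X → ℝ≥0∞) (hc : ∀ Q ∈ F, c Q < ∞) (ν : Measure X)
    (h : ∀ R ∈ F, ∑ Q ∈ F with Q ⊆ R, μ Q ≤ ν R) :
    ∑ Q ∈ F, c Q * μ Q ≤ ∫⁻ x, finMax F c x ∂ν := by
  have hcQ : ∀ Q ∈ F, c Q * μ Q =
      ∫⁻ t in Set.Ioi (0 : ℝ), (Set.Iio (c Q).toReal).indicator (fun _ => μ Q) t := by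
    intro Q hQ
    rw [lintegral_indicator_const measurableSet_Iio, Measure.restrict_apply measurableSet_Iio,
      Set.Iio_inter_Ioi, Real.volume_Ioo, sub_zero, ENNReal.ofReal_toReal (hc Q hQ).ne, mul_comm]
  rw [Finset.sum_congr rfl hcQ,
    ← lintegral_finsetSum _ fun Q _ => measurable_const.indicator measurableSet_Iio,
    lintegral_eq_lintegral_meas_ofReal_lt (measurable_finMax hmeas c) (finMax_lt_top hc)]
  refine setLIntegral_mono' measurableSet_Ioi fun t ht => ?_
  set Ft := F.filter fun Q => ENNReal.ofReal t < c Q with hFt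
  have hsub : Ft ⊆ F := Finset.filter_subset _ _
  -- Every cell above height `t` lies in a maximal one, and maximal ones are disjoint. The packing
  -- bound is used once per maximal cell, and the masses `ν R` add up inside the superlevel set.
  obtain ⟨G, hGF, hGd, hG⟩ := (hF.mono (Finset.coe_subset.2 hsub)).exists_maximal
  calc ∑ Q ∈ F, (Set.Iio (c Q).toReal).indicator (fun _ => μ Q) t
      = ∑ Q ∈ Ft, μ Q := by
        rw [hFt, Finset.sum_filter]
        refine Finset.sum_congr rfl fun Q hQ => ?_
        simp only [Set.indicator, Set.mem_Iio,
          ENNReal.ofReal_lt_iff_lt_toReal (le_of_lt (Set.mem_Ioi.1 ht)) (hc Q hQ).ne]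
    _ ≤ ∑ Q ∈ F, ∑ R ∈ G, (if Q ⊆ R then μ Q else 0) := by
        refine (Finset.sum_le_sum fun Q hQ => ?_).trans (Finset.sum_le_sum_of_subset hsub)
        obtain ⟨R, hR, hQR⟩ := hG Q hQ
        refine le_trans (by simp [hQR]) (Finset.single_le_sum
          (f := fun R => if Q ⊆ R then μ Q else 0) (fun _ _ => zero_le) hR)
    _ = ∑ R ∈ G, ∑ Q ∈ F with Q ⊆ R, μ Q := by
        rw [Finset.sum_comm]
        simp only [Finset.sum_filter]
    _ ≤ ∑ R ∈ G, ν R := Finset.sum_le_sum fun R hR => h R (hsub (hGF hR))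
    _ = ν (⋃ R ∈ G, R) :=
        (measure_biUnion_finset hGd fun R hR => hmeas R (hsub (hGF hR))).symm
    _ ≤ ν {x | ENNReal.ofReal t < finMax F c x} := by
        refine measure_mono (Set.iUnion₂_subset fun R hR x hx => ?_)
        exact lt_finMax_iff.2 ⟨R, hsub (hGF hR), (Finset.mem_filter.1 (hGF hR)).2, hx⟩

open Classical in
/-- The weak type inequality for the maximal function of a finite laminar family. -/
theorem Laminar.mul_meas_lt_finMax_le {F : Finset (Set X)}
    (hF : Laminar (F : Set (Set X))) (hmeas : ∀ Q ∈ F, MeasurableSet Q)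
    (c : Set X → ℝ≥0∞) (σ κ : Measure X) (t : ℝ≥0∞)
    (h : ∀ Q ∈ F, t < c Q → t * σ Q ≤ κ Q) :
    t * σ {x | t < finMax F c x} ≤ κ {x | t < finMax F c x} := by
  set Ft := F.filter fun Q => t < c Q with hFt
  have hsub : Ft ⊆ F := Finset.filter_subset _ _
  obtain ⟨G, hGF, hGd, hG⟩ := (hF.mono (Finset.coe_subset.2 hsub)).exists_maximal
  have hset : {x | t < finMax F c x} = ⋃ R ∈ G, id R := by
    ext x
    simp only [Set.mem_ofPred_eq, lt_finMax_iff, Set.mem_iUnion, id, exists_prop]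
    constructor
    · rintro ⟨Q, hQ, htQ, hx⟩
      obtain ⟨R, hR, hQR⟩ := hG Q (Finset.mem_filter.2 ⟨hQ, htQ⟩)
      exact ⟨R, hR, hQR hx⟩
    · rintro ⟨R, hR, hx⟩
      exact ⟨R, hsub (hGF hR), (Finset.mem_filter.1 (hGF hR)).2, hx⟩
  have hm : ∀ R ∈ G, MeasurableSet (id R) := fun R hR => hmeas R (hsub (hGF hR))
  rw [hset, measure_biUnion_finset hGd hm, measure_biUnion_finset hGd hm, Finset.mul_sum]
  exact Finset.sum_le_sum fun R hR =>
    h R (hsub (hGF hR)) (Finset.mem_filter.1 (hGF hR)).2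

/-- Doob's `L^q` inequality for the averages over a finite laminar family. -/
theorem Laminar.lintegral_finMax_average_rpow_le {F : Finset (Set X)}
    (hF : Laminar (F : Set (Set X))) (hmeas : ∀ Q ∈ F, MeasurableSet Q) (σ : Measure X)
    (hσ : ∀ Q ∈ F, σ Q ≠ 0) (hσ' : ∀ Q ∈ F, σ Q ≠ ∞) {f : X → ℝ≥0∞} (hf : AEMeasurable f σ)
    (hfin : ∀ Q ∈ F, ∫⁻ x in Q, f x ∂σ < ∞) {q : ℝ} (hq : 1 < q) :
    ∫⁻ x, finMax F (fun Q => (σ Q)⁻¹ * ∫⁻ y in Q, f y ∂σ) x ^ q ∂σ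
      ≤ ENNReal.ofReal (q / (q - 1)) ^ q * ∫⁻ x, f x ^ q ∂σ := by
  have hq0 : 0 < q := one_pos.trans hq
  have hq1 : 0 < q - 1 := sub_pos.2 hq
  set c : Set X → ℝ≥0∞ := fun Q => (σ Q)⁻¹ * ∫⁻ y in Q, f y ∂σ with hcdef
  set g := finMax F c with hg
  have hc : ∀ Q ∈ F, c Q < ∞ := fun Q hQ =>
    ENNReal.mul_lt_top (ENNReal.inv_lt_top.2 (pos_iff_ne_zero.2 (hσ Q hQ))) (hfin Q hQ)
  have hgm : Measurable g := measurable_finMax hmeas c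
  have hgfin : ∀ x, g x < ∞ := finMax_lt_top hc
  set κ := σ.withDensity f with hκ
  have hweak : ∀ t : ℝ≥0∞, t * σ {x | t < g x} ≤ κ {x | t < g x} := fun t => by
    refine hF.mul_meas_lt_finMax_le hmeas c σ κ t fun Q hQ htQ => ?_
    rw [hκ, withDensity_apply _ (hmeas Q hQ)]
    refine (mul_le_mul_left htQ.le (σ Q)).trans ?_
    rw [hcdef]
    simp only
    rw [mul_right_comm, ENNReal.inv_mul_cancel (hσ Q hQ) (hσ' Q hQ), one_mul]
  -- Integrating the weak type bound against `q * t ^ (q - 2)` gives `∫ g ^ q ≤ q / (q - 1) * ∫ f *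
  -- g ^ (q - 1)`.
  have hmain : ∫⁻ x, g x ^ q ∂σ
      ≤ ENNReal.ofReal (q / (q - 1)) * ∫⁻ x, (f * fun x => g x ^ (q - 1)) x ∂σ := by
    rw [← lintegral_withDensity_eq_lintegral_mul₀ hf (hgm.pow_const _).aemeasurable,
      lintegral_rpow_eq_lintegral_meas_ofReal_lt hgm hgfin hq0,
      lintegral_rpow_eq_lintegral_meas_ofReal_lt hgm hgfin hq1, ← mul_assoc,
      ← ENNReal.ofReal_mul (by positivity), div_mul_cancel₀ _ hq1.ne']
    refine mul_le_mul_right (setLIntegral_mono' measurableSet_Ioi fun t ht => ?_) _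
    have ht0 : 0 < t := ht
    have : t ^ (q - 1) = t * t ^ (q - 1 - 1) := by
      rw [Real.rpow_sub_one ht0.ne' (q - 1)]
      field_simp
    rw [this, ENNReal.ofReal_mul ht0.le, ← mul_assoc, mul_comm (σ _)]
    exact mul_le_mul_left (hweak _) _
  set I := ∫⁻ x, g x ^ q ∂σ with hI
  -- Finiteness, from the finiteness of `F`, is what allows the power `I ^ (1 - 1 / q)` produced by
  -- Hölder to be cancelled.
  have hI_top : I ≠ ∞ := by
    have hle : ∀ x, g x ^ q ≤ ∑ Q ∈ F, Q.indicator (fun _ => c Q ^ q) x := by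
      intro x
      rcases F.eq_empty_or_nonempty with rfl | hne
      · simp [hg, finMax, hq0]
      obtain ⟨Q, hQ, hQx⟩ := Finset.exists_mem_eq_sup F hne
        (fun Q : Set X => Q.indicator (fun _ => c Q) x)
      have : g x ^ q = Q.indicator (fun _ => c Q ^ q) x := by
        change (F.sup fun Q => Q.indicator (fun _ => c Q) x) ^ q = _
        rw [hQx]
        by_cases hx : x ∈ Q <;> simp [hx, hq0]
      rw [this]
      exact Finset.single_le_sum (f := fun Q : Set X => Q.indicator (fun _ => c Q ^ q) x)
        (fun _ _ => zero_le) hQ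
    refine ne_of_lt ((lintegral_mono hle).trans_lt ?_)
    rw [lintegral_finsetSum _ fun Q hQ => measurable_const.indicator (hmeas Q hQ)]
    refine ENNReal.sum_lt_top.2 fun Q hQ => ?_
    rw [lintegral_indicator_const (hmeas Q hQ)]
    exact ENNReal.mul_lt_top (ENNReal.rpow_lt_top_of_nonneg hq0.le (hc Q hQ).ne)
      (lt_top_iff_ne_top.2 (hσ' Q hQ))
  rcases eq_or_ne I 0 with hI0 | hI0
  · rw [hI0]; exact zero_le
  have hconj : q.HolderConjugate (q / (q - 1)) := Real.HolderConjugate.conjExponent hq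
  have hholder := ENNReal.lintegral_mul_le_Lp_mul_Lq σ hconj hf (hgm.pow_const (q - 1)).aemeasurable
  have hpow : ∀ x, (g x ^ (q - 1)) ^ (q / (q - 1)) = g x ^ q := fun x => by
    rw [← ENNReal.rpow_mul, mul_div_cancel₀ _ hq1.ne']
  simp only [hpow] at hholder
  rw [← hI] at hholder
  have hexp : 1 / (q / (q - 1)) = 1 - 1 / q := by field_simp
  rw [hexp] at hholder
  have hfinal : I ^ (1 / q) * I ^ (1 - 1 / q)
      ≤ (ENNReal.ofReal (q / (q - 1)) * (∫⁻ x, f x ^ q ∂σ) ^ (1 / q)) * I ^ (1 - 1 / q) := by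
    rw [← ENNReal.rpow_add _ _ hI0 hI_top, add_sub_cancel, ENNReal.rpow_one, mul_assoc]
    exact hmain.trans (mul_le_mul_right hholder _)
  have hle : I ^ (1 / q) ≤ ENNReal.ofReal (q / (q - 1)) * (∫⁻ x, f x ^ q ∂σ) ^ (1 / q) :=
    (ENNReal.mul_le_mul_iff_left (by simp [hI0, hI_top]) (by
      refine ENNReal.rpow_ne_top_of_nonneg ?_ hI_top
      rw [sub_nonneg, div_le_one hq0]; exact hq.le)).1 hfinal
  have := ENNReal.rpow_le_rpow hle hq0.le
  rwa [ENNReal.mul_rpow_of_nonneg _ _ hq0.le, ← ENNReal.rpow_mul, ← ENNReal.rpow_mul,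
    one_div_mul_cancel hq0.ne', ENNReal.rpow_one, ENNReal.rpow_one] at this

open Classical in
/-- Linearization of the maximal function of a finite family. -/
theorem exists_finMax_le_sum_indicator (F : Finset (Set X)) (hmeas : ∀ Q ∈ F, MeasurableSet Q)
    (c : Set X → ℝ≥0∞) :
    ∃ E : Set X → Set X, (∀ Q ∈ F, MeasurableSet (E Q)) ∧ (∀ Q ∈ F, E Q ⊆ Q) ∧
      (F : Set (Set X)).PairwiseDisjoint E ∧
      ∀ x, finMax F c x ≤ ∑ Q ∈ F, (E Q).indicator (fun _ => c Q) x := by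
  induction F using Finset.induction_on with
  | empty => exact ⟨id, by simp, by simp, by simp, fun x => by simp [finMax]⟩
  | insert R F hR ih =>
    have hF : ∀ Q ∈ F, MeasurableSet Q := fun Q hQ => hmeas Q (Finset.mem_insert_of_mem hQ)
    obtain ⟨E, hEm, hEQ, hEd, hE⟩ := ih hF
    -- The new set takes over exactly where its value strictly beats the previous maximum; the
    -- earlier sets give up `A`, which keeps disjointness.
    set A : Set X := R ∩ {x | finMax F c x < c R} with hA
    have hAm : MeasurableSet A := (hmeas R (Finset.mem_insert_self _ _)).inter
      (measurableSet_lt (measurable_finMax hF c) measurable_const)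
    have hne : ∀ Q ∈ F, Q ≠ R := fun Q hQ h => hR (h ▸ hQ)
    refine ⟨fun Q => if Q = R then A else E Q \ A, ?_, ?_, ?_, ?_⟩
    · intro Q hQ
      rcases Finset.mem_insert.1 hQ with rfl | hQ
      · simpa using hAm
      · simpa [hne Q hQ] using (hEm Q hQ).diff hAm
    · intro Q hQ
      rcases Finset.mem_insert.1 hQ with rfl | hQ
      · simp [hA]
      · simpa [hne Q hQ] using Set.sdiff_subset.trans (hEQ Q hQ)
    · intro Q hQ Q' hQ' hQQ'
      simp only [Finset.coe_insert, Set.mem_insert_iff, Finset.mem_coe] at hQ hQ'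
      simp only [Function.onFun]
      rcases hQ with rfl | hQ <;> rcases hQ' with rfl | hQ'
      · exact absurd rfl hQQ'
      · simpa [hne Q' hQ'] using Set.disjoint_sdiff_right
      · simpa [hne Q hQ] using Set.disjoint_sdiff_left
      · simpa [hne Q hQ, hne Q' hQ'] using
          (hEd hQ hQ' hQQ').mono Set.sdiff_subset Set.sdiff_subset
    · intro x
      rw [Finset.sum_insert hR]
      have hsum : ∑ Q ∈ F, (if Q = R then A else E Q \ A).indicator (fun _ => c Q) x
          = ∑ Q ∈ F, (E Q \ A).indicator (fun _ => c Q) x :=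
        Finset.sum_congr rfl fun Q hQ => by simp [hne Q hQ]
      have hins : finMax (insert R F) c x = max (R.indicator (fun _ => c R) x) (finMax F c x) := by
        simp [finMax, Finset.sup_insert]
      rw [hsum, hins]
      by_cases hx : x ∈ A
      · have hxR : x ∈ R := hx.1
        have : finMax F c x < c R := hx.2
        simp [hx, hxR, this.le]
      · have hle : R.indicator (fun _ => c R) x ≤ finMax F c x := by
          by_cases hxR : x ∈ R
          · simpa [hxR] using not_lt.1 fun h => hx ⟨hxR, h⟩
          · simp [hxR]
        rw [max_eq_right hle]
        refine (hE x).trans (le_add_left (Finset.sum_le_sum fun Q _ => ?_))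
        by_cases hxE : x ∈ E Q <;> simp [hxE, hx]

end Laminar

/-! ### Shifted dyadic grids and the one-third trick. -/

section Grid

variable {n : ℕ}

/-- The half-open cube with lower corner `a` and side `l`. -/
def halfCube (a : Fin n → ℝ) (l : ℝ) : Set (Fin n → ℝ) :=
  Set.univ.pi fun j => Set.Ico (a j) (a j + l)

theorem measurableSet_halfCube (a : Fin n → ℝ) (l : ℝ) : MeasurableSet (halfCube a l) :=
  MeasurableSet.univ_pi fun _ => measurableSet_Ico

theorem halfCube_ae_eq (a : Fin n → ℝ) (l : ℝ) :
    halfCube a l =ᵐ[volume] Set.Icc a (fun j => a j + l) :=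
  Measure.univ_pi_Ico_ae_eq_Icc

theorem halfCube_subset_Icc (a : Fin n → ℝ) (l : ℝ) :
    halfCube a l ⊆ Set.Icc a (fun j => a j + l) := fun _ hx =>
  ⟨fun j => (hx j trivial).1, fun j => (hx j trivial).2.le⟩

/-- Passes from half-open grid cells, which are laminar, to the closed cubes of the testing
condition, by taking closures. -/
theorem Icc_subset_Icc_of_halfCube_subset {a b : Fin n → ℝ} {l r : ℝ} (hl : 0 < l)
    (h : halfCube a l ⊆ halfCube b r) :
    Set.Icc a (fun j => a j + l) ⊆ Set.Icc b (fun j => b j + r) := by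
  have hcl : closure (halfCube a l) = Set.Icc a (fun j => a j + l) := by
    rw [halfCube, closure_pi_set, ← Set.pi_univ_Icc]
    simp only [closure_Ico (lt_add_of_pos_right _ hl).ne]
  rw [← hcl]
  exact closure_minimal (h.trans (halfCube_subset_Icc b r)) isClosed_Icc

theorem volume_halfCube (a : Fin n → ℝ) (l : ℝ) :
    volume (halfCube a l) = ENNReal.ofReal l ^ n := by
  simp [halfCube, Real.volume_pi_Ico]

theorem volume_cube (a : Fin n → ℝ) (l : ℝ) :
    volume (Set.Icc a (fun j => a j + l)) = ENNReal.ofReal l ^ n := by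
  simp [Real.volume_Icc_pi]

/-- The offset, in units of the side length, of the shifted dyadic intervals of generation `k`. -/
noncomputable def gridShift (b : Bool) (k : ℤ) : ℝ := if b then (-1) ^ k / 3 else 0

/-- The index of the generation `k` cell of the shifted dyadic grid containing `x`. -/
noncomputable def gridIndex (α : Fin n → Bool) (k : ℤ) (x : Fin n → ℝ) (j : Fin n) : ℤ :=
  ⌊x j * 2 ^ k - gridShift (α j) k⌋

/-- The cell of generation `k` and index `z` of the dyadic grid shifted by `α`. -/
def gridCell (α : Fin n → Bool) (k : ℤ) (z : Fin n → ℤ) : Set (Fin n → ℝ) :=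
  {x | gridIndex α k x = z}

/-- The dyadic grid shifted by `α`. -/
def grid (α : Fin n → Bool) : Set (Set (Fin n → ℝ)) :=
  Set.range fun kz : ℤ × (Fin n → ℤ) => gridCell α kz.1 kz.2

theorem countable_grid (α : Fin n → Bool) : (grid α).Countable := Set.countable_range _

theorem gridCell_eq_halfCube (α : Fin n → Bool) (k : ℤ) (z : Fin n → ℤ) :
    gridCell α k z = halfCube (fun j => (z j + gridShift (α j) k) / 2 ^ k) ((2 ^ k)⁻¹) := by
  have h2 : (0 : ℝ) < 2 ^ k := by positivity
  ext x
  simp only [gridCell, halfCube, Set.mem_ofPred_eq, funext_iff, gridIndex, Set.mem_pi,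
    Set.mem_univ, true_imp_iff, Set.mem_Ico, Int.floor_eq_iff]
  refine forall_congr' fun j => and_congr ?_ ?_
  · rw [div_le_iff₀ h2]
    constructor <;> intro h <;> linarith
  · rw [inv_eq_one_div, ← add_div, lt_div_iff₀ h2]
    constructor <;> intro h <;> linarith

theorem exists_halfCube_of_mem_grid {α : Fin n → Bool} {Q : Set (Fin n → ℝ)} (hQ : Q ∈ grid α) :
    ∃ a l, 0 < l ∧ Q = halfCube a l := by
  obtain ⟨⟨k, z⟩, rfl⟩ := hQ
  exact ⟨_, _, by positivity, gridCell_eq_halfCube α k z⟩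

/-- The shifted generations are nested because `2 * (-1) ^ k / 3` and `(-1) ^ (k + 1) / 3` differ by
the integer `(-1) ^ k`. This is why the shift alternates in sign. -/
theorem gridIndex_eq_of_succ {α : Fin n → Bool} {k : ℤ} {x y : Fin n → ℝ}
    (h : gridIndex α (k + 1) x = gridIndex α (k + 1) y) : gridIndex α k x = gridIndex α k y := by
  have hs : ∀ b, ∃ N : ℤ, 2 * gridShift b k = gridShift b (k + 1) + N := by
    intro b
    cases b
    · exact ⟨0, by simp [gridShift]⟩
    · refine ⟨(if Even k then 1 else -1), ?_⟩
      have h1 : ((-1 : ℝ)) ^ (k + 1) = - (-1) ^ k := by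
        rw [zpow_add₀ (by norm_num)]; simp
      simp only [gridShift, if_true, h1]
      split_ifs with hk
      · rw [hk.neg_one_zpow]; norm_num
      · rw [(Int.not_even_iff_odd.1 hk).neg_one_zpow]; norm_num
  have key : ∀ (x : Fin n → ℝ) (j : Fin n) (N : ℤ),
      2 * gridShift (α j) k = gridShift (α j) (k + 1) + N →
      gridIndex α k x j = (gridIndex α (k + 1) x j - N) / 2 := by
    intro x j N hN
    have : x j * 2 ^ k - gridShift (α j) k
        = (x j * 2 ^ (k + 1) - gridShift (α j) (k + 1) - N) / (2 : ℕ) := by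
      rw [zpow_add_one₀ (by norm_num)]
      push_cast
      linarith
    simp only [gridIndex]
    rw [this, Int.floor_div_natCast, Int.floor_sub_intCast]
    rfl
  funext j
  obtain ⟨N, hN⟩ := hs (α j)
  rw [key x j N hN, key y j N hN, h]

theorem gridIndex_eq_of_le {α : Fin n → Bool} {k k' : ℤ} (hk : k ≤ k') {x y : Fin n → ℝ}
    (h : gridIndex α k' x = gridIndex α k' y) : gridIndex α k x = gridIndex α k y := by
  induction k', hk using Int.leInduction with
  | base => exact h
  | succ m _ ih => exact ih (gridIndex_eq_of_succ h)

theorem laminar_grid (α : Fin n → Bool) : Laminar (grid α) := by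
  have key : ∀ k k' z z', k ≤ k' → gridCell α k' z' ⊆ gridCell α k z ∨
      Disjoint (gridCell α k z) (gridCell α k' z') := by
    intro k k' z z' hk
    by_cases hd : Disjoint (gridCell α k z) (gridCell α k' z')
    · exact Or.inr hd
    · obtain ⟨x, hx, hx'⟩ := Set.not_disjoint_iff.1 hd
      refine Or.inl fun y hy => ?_
      rw [gridCell, Set.mem_ofPred_eq] at hx hx' hy ⊢
      rw [← hx]
      exact gridIndex_eq_of_le hk (hy.trans hx'.symm)
  rintro _ ⟨⟨k, z⟩, rfl⟩ _ ⟨⟨k', z'⟩, rfl⟩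
  rcases le_total k k' with h | h
  · rcases key k k' z z' h with h | h
    · exact Or.inr (Or.inl h)
    · exact Or.inr (Or.inr h)
  · rcases key k' k z' z h with h | h
    · exact Or.inl h
    · exact Or.inr (Or.inr h.symm)

/-- If both grids separated `u` from `u + h`, there would be integers `A` and `B` with `A` and `B +
e / 3` both in `(u, u + h]`. Then `|3 * (A - B) - e| < 1`, so `3` would divide `e = ±1`. -/
theorem exists_floor_sub_gridShift_eq (k : ℤ) (u : ℝ) {h : ℝ} (h3 : h ≤ 1 / 3) (h0 : 0 ≤ h) :
    ∃ b, ⌊u - gridShift b k⌋ = ⌊u + h - gridShift b k⌋ := by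
  obtain ⟨e, he, hek⟩ : ∃ e : ℤ, (e = 1 ∨ e = -1) ∧ gridShift true k = e / 3 := by
    rcases Int.even_or_odd k with hk | hk
    · exact ⟨1, Or.inl rfl, by simp [gridShift, hk.neg_one_zpow]⟩
    · exact ⟨-1, Or.inr rfl, by simp [gridShift, hk.neg_one_zpow]⟩
  by_contra! hcon
  have step : ∀ y : ℝ, ⌊y⌋ ≠ ⌊y + h⌋ → y < ((⌊y⌋ + 1 : ℤ) : ℝ) ∧ ((⌊y⌋ + 1 : ℤ) : ℝ) ≤ y + h := by
    intro y hy
    refine ⟨by exact_mod_cast Int.lt_floor_add_one y, ?_⟩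
    rw [← Int.le_floor]
    have : ⌊y⌋ ≤ ⌊y + h⌋ := Int.floor_mono (by linarith)
    omega
  obtain ⟨a1, a2⟩ := step u (by simpa [gridShift] using hcon false)
  obtain ⟨b1, b2⟩ := step (u - e / 3) (by
    have := hcon true
    rwa [hek, show u + h - (e : ℝ) / 3 = u - e / 3 + h by ring] at this)
  set A := ⌊u⌋ + 1
  set B := ⌊u - e / 3⌋ + 1
  have h1 : ((3 * (A - B) - e : ℤ) : ℝ) < (1 : ℤ) := by push_cast; linarith
  have h2 : ((-1 : ℤ) : ℝ) < ((3 * (A - B) - e : ℤ) : ℝ) := by push_cast; linarith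
  rw [Int.cast_lt] at h1 h2
  omega

/-- Every cube is contained in a cell, of comparable volume, of one of the `2 ^ n` grids. -/
theorem IsCube.exists_grid {Q : Set (Fin n → ℝ)} (hQ : IsCube Q) :
    ∃ α, ∃ R ∈ grid α, Q ⊆ R ∧ volume R ≤ 6 ^ n * volume Q := by
  obtain ⟨a, l, hl, rfl⟩ := hQ
  -- The cell side `2 ^ (-k)` satisfies `3 * l ≤ 2 ^ (-k) < 6 * l`: large enough for the one-third
  -- trick, with volume ratio at most `6 ^ n`.
  obtain ⟨k, hk1, hk2⟩ := exists_mem_Ico_zpow (x := 1 / (3 * l)) (y := 2) (by positivity)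
    (by norm_num)
  have h2 : (0 : ℝ) < 2 ^ k := by positivity
  have hk1' : l * 2 ^ k ≤ 1 / 3 := by
    rw [le_div_iff₀ (by positivity)] at hk1
    linarith
  have hk2' : 1 < 6 * l * 2 ^ k := by
    rw [zpow_add_one₀ (by norm_num), div_lt_iff₀ (by positivity)] at hk2
    linarith
  choose α hα using fun j => exists_floor_sub_gridShift_eq k (a j * 2 ^ k) hk1' (by positivity)
  refine ⟨α, gridCell α k (gridIndex α k a), ⟨(k, _), rfl⟩, fun x hx => ?_, ?_⟩
  · refine funext fun j => le_antisymm ?_ (Int.floor_mono ?_)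
    · change _ ≤ ⌊_⌋
      rw [hα j]
      refine Int.floor_mono ?_
      have := mul_le_mul_of_nonneg_right (hx.2 j) h2.le
      simp only at this
      linarith
    · have := mul_le_mul_of_nonneg_right (hx.1 j) h2.le
      linarith
  · rw [gridCell_eq_halfCube, volume_halfCube, volume_cube, ← mul_pow]
    refine pow_le_pow_left' ?_ n
    rw [show (6 : ℝ≥0∞) = ENNReal.ofReal 6 by simp, ← ENNReal.ofReal_mul (by norm_num)]
    refine ENNReal.ofReal_le_ofReal ?_
    rw [inv_le_iff_one_le_mul₀ h2]
    exact hk2'.le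

end Grid

/-! ### The two-weight estimate, first over finite families of cells, then for all cubes. -/

section TwoWeight

variable {n m : ℕ}

/-- Holds for arbitrary `g` because the density is finite everywhere; so it applies to powers of
`maxFn` without measurability of the latter. -/
theorem setLIntegral_mul_ofReal_eq_wMeasure {v : (Fin n → ℝ) → ℝ} (hv : AEMeasurable v volume)
    (g : (Fin n → ℝ) → ℝ≥0∞) {Q : Set (Fin n → ℝ)} (hQ : MeasurableSet Q) :
    ∫⁻ x in Q, g x * ENNReal.ofReal (v x) = ∫⁻ x in Q, g x ∂wMeasure v := by
  rw [wMeasure, restrict_withDensity hQ,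
    lintegral_withDensity_eq_lintegral_mul_non_measurable₀ _ hv.ennreal_ofReal.restrict
      (Filter.Eventually.of_forall fun _ => ENNReal.ofReal_lt_top)]
  simp only [Pi.mul_apply, mul_comm]

theorem lintegral_mul_ofReal_eq_wMeasure {v : (Fin n → ℝ) → ℝ} (hv : AEMeasurable v volume)
    (g : (Fin n → ℝ) → ℝ≥0∞) :
    ∫⁻ x, g x * ENNReal.ofReal (v x) = ∫⁻ x, g x ∂wMeasure v := by
  simpa using setLIntegral_mul_ofReal_eq_wMeasure hv g MeasurableSet.univ

theorem setLIntegral_enorm_mul_eq_wMeasure {u : (Fin n → ℝ) → ℝ} (hu : AEMeasurable u volume)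
    (hpos : ∀ᵐ x, 0 < u x) (f : (Fin n → ℝ) → ℝ) {Q : Set (Fin n → ℝ)} (hQ : MeasurableSet Q) :
    ∫⁻ x in Q, ‖f x * u x‖ₑ = ∫⁻ x in Q, ‖f x‖ₑ ∂wMeasure u := by
  rw [← setLIntegral_mul_ofReal_eq_wMeasure hu _ hQ]
  refine lintegral_congr_ae (ae_restrict_of_ae (hpos.mono fun x hx => ?_))
  simp only [enorm_mul, Real.enorm_of_nonneg hx.le]

theorem setLIntegral_enorm_eq_wMeasure {u : (Fin n → ℝ) → ℝ} (hu : AEMeasurable u volume)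
    (hpos : ∀ᵐ x, 0 < u x) {Q : Set (Fin n → ℝ)} (hQ : MeasurableSet Q) :
    ∫⁻ x in Q, ‖u x‖ₑ = wMeasure u Q := by
  simpa using setLIntegral_enorm_mul_eq_wMeasure hu hpos (fun _ => 1) hQ

theorem IsCube.measurableSet {Q : Set (Fin n → ℝ)} (hQ : IsCube Q) : MeasurableSet Q := by
  obtain ⟨a, l, -, rfl⟩ := hQ
  exact measurableSet_Icc

theorem IsCube.volume_ne_zero {Q : Set (Fin n → ℝ)} (hQ : IsCube Q) : volume Q ≠ 0 := by
  obtain ⟨a, l, hl, rfl⟩ := hQ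
  rw [volume_cube]
  simp [hl]

theorem IsCube.wMeasure_ne_zero {u : (Fin n → ℝ) → ℝ} (hu : AEMeasurable u volume)
    (hpos : ∀ᵐ x, 0 < u x) {Q : Set (Fin n → ℝ)} (hQ : IsCube Q) : wMeasure u Q ≠ 0 := by
  intro h
  have hac : volume ≪ wMeasure u :=
    withDensity_absolutelyContinuous' hu.ennreal_ofReal
      (hpos.mono fun x hx => (ENNReal.ofReal_pos.2 hx).ne')
  exact hQ.volume_ne_zero (hac h)

theorem IsCube.wMeasure_ne_top {u : (Fin n → ℝ) → ℝ} (hu : LocallyIntegrable u volume)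
    {Q : Set (Fin n → ℝ)} (hQ : IsCube Q) : wMeasure u Q ≠ ∞ := by
  rw [wMeasure, withDensity_apply _ hQ.measurableSet]
  obtain ⟨a, l, -, rfl⟩ := hQ
  refine ne_of_lt (lt_of_le_of_lt (lintegral_mono fun x => ?_)
    (hu.integrableOn_isCompact isCompact_Icc).2)
  exact Real.ofReal_le_enorm (u x)

theorem finMax_rpow_le {X : Type*} (F : Finset (Set X)) (c : Set X → ℝ≥0∞) {p : ℝ} (hp : 0 < p)
    (x : X) : finMax F c x ^ p ≤ finMax F (fun Q => c Q ^ p) x := by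
  rw [← ENNReal.le_rpow_inv_iff hp]
  refine finMax_le fun Q hQ hx => (ENNReal.le_rpow_inv_iff hp).2 ?_
  exact le_finMax (fun Q => c Q ^ p) hQ hx

/-- The averages of `|σᵢ|` over a cube `Q ⊆ R` are bounded by the local maximal function. -/
theorem prod_average_le_maxFn_indicator {u : Fin m → (Fin n → ℝ) → ℝ}
    (hu : ∀ i, AEMeasurable (u i) volume) (hpos : ∀ i, ∀ᵐ x, 0 < u i x)
    {Q R : Set (Fin n → ℝ)} (hQ : IsCube Q) (hQR : Q ⊆ R) {x : Fin n → ℝ} (hx : x ∈ Q) :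
    ∏ i, ((volume Q)⁻¹ * wMeasure (u i) Q) ≤ maxFn (fun i => R.indicator (u i)) x := by
  refine le_trans (le_of_eq ?_) (le_iSup_of_le Q (le_iSup_of_le hQ (le_iSup_of_le hx le_rfl)))
  refine Finset.prod_congr rfl fun i _ => ?_
  rw [← setLIntegral_enorm_eq_wMeasure (hu i) (hpos i) hQ.measurableSet]
  congr 1
  refine setLIntegral_congr_fun hQ.measurableSet fun y hy => ?_
  simp only [Set.indicator_of_mem (hQR hy)]

open Classical in
/-- The two-weight inequality for the maximal function over a finite family of grid cells. -/
theorem lintegral_finMax_rpow_le {P : Fin m → ℝ} (hP : ∀ i, 1 < P i) {p : ℝ} (hp0 : 0 < p)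
    (hp : ∑ i, p / P i = 1) {V : Measure (Fin n → ℝ)} {u : Fin m → (Fin n → ℝ) → ℝ}
    (hu : ∀ i, AEMeasurable (u i) volume) (hpos : ∀ i, ∀ᵐ x, 0 < u i x)
    (hloc : ∀ i, LocallyIntegrable (u i) volume) {S C : ℝ≥0∞}
    (hS : ∀ R, IsCube R → ∫⁻ x in R, maxFn (fun i => R.indicator (u i)) x ^ p ∂V
      ≤ S * ∏ i, wMeasure (u i) R ^ (p / P i))
    (hC : ∀ R, IsCube R → ∏ i, wMeasure (u i) R ^ (p / P i)
      ≤ C * ∫⁻ x in R, ∏ i, ENNReal.ofReal (u i x) ^ (p / P i))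
    {φ : Fin m → (Fin n → ℝ) → ℝ≥0∞} (hφ : ∀ i, AEMeasurable (φ i) (wMeasure (u i)))
    {α : Fin n → Bool} {F : Finset (Set (Fin n → ℝ))} (hF : ↑F ⊆ grid α)
    (hφfin : ∀ Q ∈ F, ∀ i, ∫⁻ x in Q, φ i x ∂wMeasure (u i) < ∞) :
    ∫⁻ x, finMax F (fun Q => ∏ i, ((volume Q)⁻¹ * ∫⁻ y in Q, φ i y ∂wMeasure (u i))) x ^ p ∂V
      ≤ S * C * ∏ i, (ENNReal.ofReal (P i / (P i - 1)) ^ p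
        * (∫⁻ x, φ i x ^ P i ∂wMeasure (u i)) ^ (p / P i)) := by
  have hlam : Laminar (F : Set (Set (Fin n → ℝ))) := (laminar_grid α).mono hF
  have hcube : ∀ Q ∈ F, ∃ a l, 0 < l ∧ Q = halfCube a l := fun Q hQ =>
    exists_halfCube_of_mem_grid (hF hQ)
  have hmeas : ∀ Q ∈ F, MeasurableSet Q := by
    intro Q hQ
    obtain ⟨a, l, -, rfl⟩ := hcube Q hQ
    exact measurableSet_halfCube a l
  have hcl : ∀ i a l, wMeasure (u i) (halfCube a l)
      = wMeasure (u i) (Set.Icc a (fun j => a j + l)) := fun i a l =>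
    measure_congr ((withDensity_absolutelyContinuous _ _).ae_eq (halfCube_ae_eq a l))
  have hσ0 : ∀ i, ∀ Q ∈ F, wMeasure (u i) Q ≠ 0 := by
    intro i Q hQ
    obtain ⟨a, l, hl, rfl⟩ := hcube Q hQ
    rw [hcl]
    exact IsCube.wMeasure_ne_zero (hu i) (hpos i) ⟨a, l, hl, rfl⟩
  have hσt : ∀ i, ∀ Q ∈ F, wMeasure (u i) Q ≠ ∞ := by
    intro i Q hQ
    obtain ⟨a, l, hl, rfl⟩ := hcube Q hQ
    rw [hcl]
    exact IsCube.wMeasure_ne_top (hloc i) ⟨a, l, hl, rfl⟩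
  set avg : Set (Fin n → ℝ) → ℝ≥0∞ :=
    fun Q => ∏ i, ((volume Q)⁻¹ * ∫⁻ y in Q, φ i y ∂wMeasure (u i)) with havg
  set τ : Set (Fin n → ℝ) → ℝ≥0∞ := fun Q => ∏ i, ((volume Q)⁻¹ * wMeasure (u i) Q) with hτ
  set b : Fin m → Set (Fin n → ℝ) → ℝ≥0∞ :=
    fun i Q => (wMeasure (u i) Q)⁻¹ * ∫⁻ y in Q, φ i y ∂wMeasure (u i) with hb
  -- Multiplying and dividing by `σᵢ(Q)`, which is neither `0` nor `∞`, isolates the weighted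
  -- averages `b i Q` from the purely weight-dependent `τ Q`.
  have hsplit : ∀ Q ∈ F, avg Q ^ p = (∏ i, b i Q) ^ p * τ Q ^ p := by
    intro Q hQ
    rw [← ENNReal.mul_rpow_of_nonneg _ _ hp0.le]
    congr 1
    simp only [havg, hτ, hb]
    rw [← Finset.prod_mul_distrib]
    refine Finset.prod_congr rfl fun i _ => ?_
    rw [mul_mul_mul_comm, mul_comm (wMeasure (u i) Q)⁻¹, mul_assoc, mul_comm (∫⁻ _ in Q, _ ∂_),
      ← mul_assoc (wMeasure (u i) Q)⁻¹,
      ENNReal.inv_mul_cancel (hσ0 i Q hQ) (hσt i Q hQ), one_mul]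
  have hbfin : ∀ Q ∈ F, (∏ i, b i Q) ^ p < ∞ := by
    intro Q hQ
    refine ENNReal.rpow_lt_top_of_nonneg hp0.le (ENNReal.prod_lt_top fun i _ => ?_).ne
    exact ENNReal.mul_lt_top (ENNReal.inv_lt_top.2 (pos_iff_ne_zero.2 (hσ0 i Q hQ)))
      (hφfin Q hQ i)
  obtain ⟨E, hEm, hEQ, hEd, hE⟩ := exists_finMax_le_sum_indicator F hmeas (fun Q => avg Q ^ p)
  set ν : Measure (Fin n → ℝ) := (S * C) • volume.withDensity
    (fun x => ∏ i, ENNReal.ofReal (u i x) ^ (p / P i)) with hν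
  have hum : AEMeasurable (fun x => ∏ i, ENNReal.ofReal (u i x) ^ (p / P i)) volume :=
    Finset.aemeasurable_fun_prod _ fun i _ => (hu i).ennreal_ofReal.pow_const _
  -- On `E Q` with `Q ⊆ R`, `τ Q` is at most the local maximal function of `R'`, the closure of `R`.
  -- The sets `E Q` are disjoint, so the testing condition on `R'` applies once; reverse Hölder
  -- turns its right side into `ν R`.
  have hcarleson : ∀ R ∈ F, ∑ Q ∈ F with Q ⊆ R, τ Q ^ p * V (E Q) ≤ ν R := by
    intro R hR
    obtain ⟨a, r, hr, hRe⟩ := hcube R hR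
    set R' : Set (Fin n → ℝ) := Set.Icc a (fun j => a j + r) with hR'
    have hR'c : IsCube R' := ⟨a, r, hr, rfl⟩
    calc ∑ Q ∈ F with Q ⊆ R, τ Q ^ p * V (E Q)
        ≤ ∑ Q ∈ F with Q ⊆ R, ∫⁻ x in E Q, maxFn (fun i => R'.indicator (u i)) x ^ p ∂V := by
          refine Finset.sum_le_sum fun Q hQ => ?_
          rw [Finset.mem_filter] at hQ
          rw [← setLIntegral_const]
          refine setLIntegral_mono' (hEm Q hQ.1) fun x hx => ENNReal.rpow_le_rpow ?_ hp0.le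
          obtain ⟨a', l, hl, rfl⟩ := hcube Q hQ.1
          have := prod_average_le_maxFn_indicator (R := R') hu hpos ⟨a', l, hl, rfl⟩
            (Icc_subset_Icc_of_halfCube_subset hl (hQ.2.trans hRe.subset))
            (halfCube_subset_Icc _ _ (hEQ _ hQ.1 hx))
          simpa only [hτ, hcl, measure_congr (halfCube_ae_eq a' l)] using this
      _ = ∫⁻ x in ⋃ Q ∈ F.filter (· ⊆ R), E Q, maxFn (fun i => R'.indicator (u i)) x ^ p ∂V := by
          refine (lintegral_biUnion_finset ?_ (fun Q hQ => hEm Q (Finset.mem_filter.1 hQ).1)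
            _).symm
          exact hEd.subset (Finset.coe_subset.2 (Finset.filter_subset _ _))
      _ ≤ ∫⁻ x in R', maxFn (fun i => R'.indicator (u i)) x ^ p ∂V := by
          refine lintegral_mono_set (Set.iUnion₂_subset fun Q hQ => ?_)
          rw [Finset.mem_filter] at hQ
          exact (hEQ Q hQ.1).trans (hQ.2.trans (hRe ▸ halfCube_subset_Icc a r))
      _ ≤ S * (C * ∫⁻ x in R', ∏ i, ENNReal.ofReal (u i x) ^ (p / P i)) :=
          (hS R' hR'c).trans (mul_le_mul_right (hC R' hR'c) _)
      _ = ν R := by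
          rw [hν, Measure.smul_apply, withDensity_apply _ (hmeas R hR), smul_eq_mul, mul_assoc,
            hRe, setLIntegral_congr (halfCube_ae_eq a r)]
  calc ∫⁻ x, finMax F avg x ^ p ∂V
      ≤ ∫⁻ x, ∑ Q ∈ F, (E Q).indicator (fun _ => avg Q ^ p) x ∂V :=
        lintegral_mono fun x => (finMax_rpow_le F avg hp0 x).trans (hE x)
    _ = ∑ Q ∈ F, (∏ i, b i Q) ^ p * (τ Q ^ p * V (E Q)) := by
        rw [lintegral_finsetSum' _ fun Q hQ =>
          (measurable_const.indicator (hEm Q hQ)).aemeasurable]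
        refine Finset.sum_congr rfl fun Q hQ => ?_
        rw [lintegral_indicator_const (hEm Q hQ), hsplit Q hQ, mul_assoc]
    _ ≤ ∫⁻ x, finMax F (fun Q => (∏ i, b i Q) ^ p) x ∂ν :=
        hlam.sum_mul_le_lintegral_finMax hmeas _ _ hbfin ν hcarleson
    _ = S * C * ∫⁻ x, (∏ i, ENNReal.ofReal (u i x) ^ (p / P i))
          * finMax F (fun Q => (∏ i, b i Q) ^ p) x := by
        rw [hν, lintegral_smul_measure, smul_eq_mul, lintegral_withDensity_eq_lintegral_mul₀ hum
          (measurable_finMax hmeas _).aemeasurable]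
        rfl
    _ ≤ S * C * ∫⁻ x, ∏ i, (ENNReal.ofReal (u i x) * finMax F (b i) x ^ P i) ^ (p / P i) := by
        refine mul_le_mul_right (lintegral_mono fun x => ?_) _
        have hpow : ∀ i, (ENNReal.ofReal (u i x) * finMax F (b i) x ^ P i) ^ (p / P i)
            = ENNReal.ofReal (u i x) ^ (p / P i) * finMax F (b i) x ^ p := fun i => by
          have hPi : 0 < P i := one_pos.trans (hP i)
          rw [ENNReal.mul_rpow_of_nonneg _ _ (by positivity), ← ENNReal.rpow_mul,
            mul_div_cancel₀ _ hPi.ne']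
        simp only [hpow, Finset.prod_mul_distrib]
        refine mul_le_mul_right (finMax_le fun Q hQ hx => ?_) _
        rw [← ENNReal.prod_rpow_of_nonneg hp0.le]
        exact Finset.prod_le_prod' fun i _ => ENNReal.rpow_le_rpow (le_finMax (b i) hQ hx) hp0.le
    -- Hölder's inequality, the exponents `p / P i` summing to one.
    _ ≤ S * C * ∏ i, (∫⁻ x, ENNReal.ofReal (u i x) * finMax F (b i) x ^ P i) ^ (p / P i) := by
        refine mul_le_mul_right (ENNReal.lintegral_prod_norm_pow_le _ (fun i _ => ?_) hp
          fun i _ => ?_) _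
        · exact (hu i).ennreal_ofReal.mul ((measurable_finMax hmeas _).pow_const _).aemeasurable
        · have hPi : 0 < P i := one_pos.trans (hP i)
          positivity
    _ ≤ _ := by
        refine mul_le_mul_right (Finset.prod_le_prod' fun i _ => ?_) _
        have hPi : 0 < P i := one_pos.trans (hP i)
        have h1 : ∫⁻ x, ENNReal.ofReal (u i x) * finMax F (b i) x ^ P i
            = ∫⁻ x, finMax F (b i) x ^ P i ∂wMeasure (u i) := by
          rw [← lintegral_mul_ofReal_eq_wMeasure (hu i)]
          simp only [mul_comm]
        have h2 := hlam.lintegral_finMax_average_rpow_le hmeas (wMeasure (u i)) (hσ0 i) (hσt i)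
          (hφ i) (fun Q hQ => hφfin Q hQ i) (hP i)
        rw [h1]
        refine (ENNReal.rpow_le_rpow h2 (by positivity)).trans (le_of_eq ?_)
        rw [ENNReal.mul_rpow_of_nonneg _ _ (by positivity), ← ENNReal.rpow_mul,
          mul_div_cancel₀ _ hPi.ne']

/-- The pointwise control of the maximal function by the `2 ^ n` dyadic maximal functions. -/
theorem maxFn_mul_rpow_le {u : Fin m → (Fin n → ℝ) → ℝ}
    (hu : ∀ i, AEMeasurable (u i) volume) (hpos : ∀ i, ∀ᵐ x, 0 < u i x)
    (f : Fin m → (Fin n → ℝ) → ℝ) {p : ℝ} (hp0 : 0 < p) (x : Fin n → ℝ) :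
    maxFn (fun i y => f i y * u i y) x ^ p ≤ ((6 : ℝ≥0∞) ^ (n * m)) ^ p *
      ∑ α : Fin n → Bool, ⨆ F : Finset (grid α), finMax (F.map (Function.Embedding.subtype _))
        (fun Q => ∏ i, ((volume Q)⁻¹ * ∫⁻ y in Q, ‖f i y‖ₑ ∂wMeasure (u i))) x ^ p := by
  rw [← ENNReal.le_rpow_inv_iff hp0, ENNReal.mul_rpow_of_nonneg _ _ (by positivity),
    ENNReal.rpow_rpow_inv hp0.ne']
  refine iSup_le fun Q => iSup_le fun hQ => iSup_le fun hx => ?_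
  obtain ⟨α, R, hR, hQR, hvol⟩ := hQ.exists_grid
  have hfac : ∀ i, (volume Q)⁻¹ * ∫⁻ y in Q, ‖f i y * u i y‖ₑ
      ≤ 6 ^ n * ((volume R)⁻¹ * ∫⁻ y in R, ‖f i y‖ₑ ∂wMeasure (u i)) := by
    intro i
    rw [setLIntegral_enorm_mul_eq_wMeasure (hu i) (hpos i) _ hQ.measurableSet, ← mul_assoc]
    refine mul_le_mul' ?_ (lintegral_mono_set hQR)
    have h6 : (6 : ℝ≥0∞) ^ n ≠ 0 := by positivity
    have h6' : (6 : ℝ≥0∞) ^ n ≠ ∞ := ENNReal.pow_ne_top (by simp)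
    calc (volume Q)⁻¹ = 6 ^ n * (6 ^ n * volume Q)⁻¹ := by
          rw [ENNReal.mul_inv (Or.inl h6) (Or.inl h6'), ← mul_assoc,
            ENNReal.mul_inv_cancel h6 h6', one_mul]
      _ ≤ 6 ^ n * (volume R)⁻¹ := mul_le_mul_right (ENNReal.inv_le_inv.2 hvol) _
  refine (Finset.prod_le_prod' fun i _ => hfac i).trans ?_
  rw [Finset.prod_mul_distrib, Finset.prod_const, Finset.card_univ, Fintype.card_fin, ← pow_mul]
  refine mul_le_mul_right ((ENNReal.le_rpow_inv_iff hp0).2 ?_) _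
  -- One grid depends on `Q`; summing over all of them makes the bound uniform in `Q`.
  refine le_trans ?_ (Finset.single_le_sum (f := fun α : Fin n → Bool =>
    ⨆ F : Finset (grid α), finMax (F.map (Function.Embedding.subtype _))
        (fun Q => ∏ i, ((volume Q)⁻¹ * ∫⁻ y in Q, ‖f i y‖ₑ ∂wMeasure (u i))) x ^ p)
    (fun _ _ => zero_le) (Finset.mem_univ α))
  refine le_iSup_of_le {⟨R, hR⟩} (ENNReal.rpow_le_rpow ?_ hp0.le)
  exact le_finMax (fun Q => ∏ i, ((volume Q)⁻¹ * ∫⁻ y in Q, ‖f i y‖ₑ ∂wMeasure (u i)))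
    (by simp) (hQR hx)

/-- Sufficiency of the testing condition, given the multiple reverse Hölder inequality. -/
theorem lintegral_maxFn_mul_rpow_le {P : Fin m → ℝ} (hP : ∀ i, 1 < P i) {p : ℝ} (hp0 : 0 < p)
    (hp : ∑ i, p / P i = 1) {V : Measure (Fin n → ℝ)} {u : Fin m → (Fin n → ℝ) → ℝ}
    (hu : ∀ i, AEMeasurable (u i) volume) (hpos : ∀ i, ∀ᵐ x, 0 < u i x)
    (hloc : ∀ i, LocallyIntegrable (u i) volume) {S C : ℝ≥0∞}
    (hS : ∀ R, IsCube R → ∫⁻ x in R, maxFn (fun i => R.indicator (u i)) x ^ p ∂V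
      ≤ S * ∏ i, wMeasure (u i) R ^ (p / P i))
    (hC : ∀ R, IsCube R → ∏ i, wMeasure (u i) R ^ (p / P i)
      ≤ C * ∫⁻ x in R, ∏ i, ENNReal.ofReal (u i x) ^ (p / P i))
    {f : Fin m → (Fin n → ℝ) → ℝ}
    (hf : ∀ i, MemLp (f i) (ENNReal.ofReal (P i)) (wMeasure (u i))) :
    ∫⁻ x, maxFn (fun i y => f i y * u i y) x ^ p ∂V
      ≤ ((6 : ℝ≥0∞) ^ (n * m)) ^ p * (2 ^ n * (S * C *
        ∏ i, (ENNReal.ofReal (P i / (P i - 1)) ^ p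
          * (∫⁻ x, ‖f i x‖ₑ ^ P i ∂wMeasure (u i)) ^ (p / P i)))) := by
  set K := S * C * ∏ i, (ENNReal.ofReal (P i / (P i - 1)) ^ p
          * (∫⁻ x, ‖f i x‖ₑ ^ P i ∂wMeasure (u i)) ^ (p / P i)) with hK
  set avg : Set (Fin n → ℝ) → ℝ≥0∞ :=
    fun Q => ∏ i, ((volume Q)⁻¹ * ∫⁻ y in Q, ‖f i y‖ₑ ∂wMeasure (u i)) with havg
  have hmeas : ∀ (α : Fin n → Bool) (F : Finset (grid α)), Measurable fun x =>
      finMax (F.map (Function.Embedding.subtype _)) avg x ^ p := by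
    intro α F
    refine (measurable_finMax (fun Q hQ => ?_) avg).pow_const p
    obtain ⟨Q, -, rfl⟩ := Finset.mem_map.1 hQ
    obtain ⟨a, l, -, h⟩ := exists_halfCube_of_mem_grid Q.2
    exact (congrArg MeasurableSet h).mpr (measurableSet_halfCube a l)
  have hfin : ∀ Q : Set (Fin n → ℝ), (∃ a l, 0 < l ∧ Q = halfCube a l) → ∀ i,
      ∫⁻ x in Q, ‖f i x‖ₑ ∂wMeasure (u i) < ∞ := by
    rintro _ ⟨a, l, hl, rfl⟩ i
    refine (lintegral_mono_set (halfCube_subset_Icc a l)).trans_lt ?_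
    have hcube : IsCube (Set.Icc a (fun j => a j + l)) := ⟨a, l, hl, rfl⟩
    have : IsFiniteMeasure ((wMeasure (u i)).restrict (Set.Icc a (fun j => a j + l))) :=
      ⟨by simpa using lt_top_iff_ne_top.2 (hcube.wMeasure_ne_top (hloc i))⟩
    exact (((hf i).restrict _).integrable
      (by rw [ENNReal.one_le_ofReal]; exact (hP i).le)).2
  have hgrid : ∀ α : Fin n → Bool, ∫⁻ x, ⨆ F : Finset (grid α),
      finMax (F.map (Function.Embedding.subtype _)) avg x ^ p ∂V ≤ K := by
    intro α
    have : Countable (grid α) := (countable_grid α).to_subtype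
    classical
    -- Monotone convergence: the grid is countable, and the maximal functions increase along finite
    -- subfamilies, with a bound independent of the subfamily.
    rw [lintegral_iSup_directed (fun F => (hmeas α F).aemeasurable)]
    · refine iSup_le fun F => ?_
      have hF : ↑(F.map (Function.Embedding.subtype _)) ⊆ grid α := by
        intro Q hQ
        obtain ⟨Q, -, rfl⟩ := Finset.mem_map.1 hQ
        exact Q.2
      exact lintegral_finMax_rpow_le hP hp0 hp hu hpos hloc hS hC
        (fun i => (hf i).1.enorm) hF fun Q hQ => hfin Q (exists_halfCube_of_mem_grid (hF hQ))
    · refine Monotone.directed_le fun F G hFG x => ENNReal.rpow_le_rpow ?_ hp0.le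
      exact finMax_mono (Finset.map_subset_map.2 hFG) avg x
  calc ∫⁻ x, maxFn (fun i y => f i y * u i y) x ^ p ∂V
      ≤ ∫⁻ x, ((6 : ℝ≥0∞) ^ (n * m)) ^ p * ∑ α : Fin n → Bool, ⨆ F : Finset (grid α),
          finMax (F.map (Function.Embedding.subtype _)) avg x ^ p ∂V :=
        lintegral_mono fun x => maxFn_mul_rpow_le hu hpos f hp0 x
    _ = ((6 : ℝ≥0∞) ^ (n * m)) ^ p * ∑ α : Fin n → Bool, ∫⁻ x, ⨆ F : Finset (grid α),
          finMax (F.map (Function.Embedding.subtype _)) avg x ^ p ∂V := by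
        have hsup : ∀ α : Fin n → Bool, Measurable fun x => ⨆ F : Finset (grid α),
            finMax (F.map (Function.Embedding.subtype _)) avg x ^ p := fun α => by
          have : Countable (grid α) := (countable_grid α).to_subtype
          exact Measurable.iSup (hmeas α)
        rw [lintegral_const_mul _ (Finset.measurable_fun_sum _ fun α _ => hsup α),
          lintegral_finsetSum _ fun α _ => hsup α]
    _ ≤ ((6 : ℝ≥0∞) ^ (n * m)) ^ p * ∑ _α : Fin n → Bool, K :=
        mul_le_mul_right (Finset.sum_le_sum fun α _ => hgrid α) _
    _ = _ := by simp

end TwoWeight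

/-! ### Optimal constants, necessity, and the final theorem. -/

section Main

variable {n m : ℕ}

theorem aemeasurable_dualWeight {P : Fin m → ℝ} {w : Fin m → (Fin n → ℝ) → ℝ} {i : Fin m}
    (hw : AEMeasurable (w i) volume) : AEMeasurable (dualWeight P w i) volume :=
  hw.pow_const _

theorem dualWeight_pos {P : Fin m → ℝ} {w : Fin m → (Fin n → ℝ) → ℝ} {i : Fin m}
    (hw : ∀ᵐ x, 0 < w i x) : ∀ᵐ x, 0 < dualWeight P w i x :=
  hw.mono fun _ hx => Real.rpow_pos_of_pos hx _

theorem setLIntegral_ofReal_eq_wMeasure (u : (Fin n → ℝ) → ℝ) {Q : Set (Fin n → ℝ)}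
    (hQ : IsCube Q) : ∫⁻ x in Q, ENNReal.ofReal (u x) = wMeasure u Q :=
  (withDensity_apply _ hQ.measurableSet).symm

section Weights

variable {P : Fin m → ℝ} {p : ℝ} {w : Fin m → (Fin n → ℝ) → ℝ}

/-- The reverse Hölder inequality holds with the smallest constant. -/
theorem RHCond.rhBound_rhConst (hP : ∀ i, 1 < P i) (hp0 : 0 < p) (hp : ∑ i, p / P i = 1)
    (hw : ∀ i, AEMeasurable (w i) volume)
    (hloc : ∀ i, LocallyIntegrable (dualWeight P w i) volume) (h : RHCond P p w) :
    RHBound P p w (rhConst P p w) := by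
  obtain ⟨C, -, hC⟩ := h
  have hexp : ∀ i, 0 ≤ p / P i := fun i => div_nonneg hp0.le (one_pos.trans (hP i)).le
  have hfin : rhConst P p w ≠ ∞ := ((sInf_le hC).trans_lt ENNReal.ofReal_lt_top).ne
  intro Q hQ
  -- Hölder and local integrability make this integral finite, so one may divide by it and pass to
  -- the infimum of constants. A zero integral does no harm since `rhConst` is finite.
  have htop : ∫⁻ x in Q, ∏ i, ENNReal.ofReal (dualWeight P w i x) ^ (p / P i) ≠ ∞ := by
    refine ne_of_lt ((ENNReal.lintegral_prod_norm_pow_le _ (fun i _ =>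
      (aemeasurable_dualWeight (hw i)).ennreal_ofReal.restrict) hp fun i _ => hexp i).trans_lt ?_)
    refine ENNReal.prod_lt_top fun i _ => ENNReal.rpow_lt_top_of_nonneg (hexp i) ?_
    rw [setLIntegral_ofReal_eq_wMeasure _ hQ]
    exact hQ.wMeasure_ne_top (hloc i)
  rw [← ENNReal.div_le_iff_le_mul (Or.inr hfin) (Or.inl htop)]
  exact le_sInf fun D hD => ENNReal.div_le_of_le_mul (hD Q hQ)

theorem rhConst_lt_top (h : RHCond P p w) : rhConst P p w < ∞ := by
  obtain ⟨C, -, hC⟩ := h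
  exact (sInf_le hC).trans_lt ENNReal.ofReal_lt_top

theorem prod_wMeasure_rpow_ne_zero {u : Fin m → (Fin n → ℝ) → ℝ}
    (hu : ∀ i, AEMeasurable (u i) volume) (hpos : ∀ i, ∀ᵐ x, 0 < u i x) {r : Fin m → ℝ}
    (hr : ∀ i, 0 ≤ r i) {Q : Set (Fin n → ℝ)} (hQ : IsCube Q) :
    ∏ i, wMeasure (u i) Q ^ r i ≠ 0 :=
  Finset.prod_ne_zero_iff.2 fun i _ => by
    simp [hQ.wMeasure_ne_zero (hu i) (hpos i), (hr i).not_gt]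

theorem prod_wMeasure_rpow_ne_top {u : Fin m → (Fin n → ℝ) → ℝ}
    (hloc : ∀ i, LocallyIntegrable (u i) volume) {r : Fin m → ℝ}
    (hr : ∀ i, 0 ≤ r i) {Q : Set (Fin n → ℝ)} (hQ : IsCube Q) :
    ∏ i, wMeasure (u i) Q ^ r i ≠ ∞ :=
  (ENNReal.prod_lt_top fun i _ =>
    ENNReal.rpow_lt_top_of_nonneg (hr i) (hQ.wMeasure_ne_top (hloc i))).ne

/-- The local testing inequality expressed by the Sawyer constant. -/
theorem setLIntegral_maxFn_indicator_rpow_le_sawyerConst (hP : ∀ i, 1 < P i) (hp0 : 0 < p)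
    {v : (Fin n → ℝ) → ℝ} (hv : AEMeasurable v volume)
    (hw : ∀ i, AEMeasurable (w i) volume) (hpos : ∀ i, ∀ᵐ x, 0 < w i x)
    (hloc : ∀ i, LocallyIntegrable (dualWeight P w i) volume)
    {R : Set (Fin n → ℝ)} (hR : IsCube R) :
    ∫⁻ x in R, maxFn (fun i => R.indicator (dualWeight P w i)) x ^ p ∂wMeasure v
      ≤ sawyerConst P p v w ^ p * ∏ i, wMeasure (dualWeight P w i) R ^ (p / P i) := by
  have hr : ∀ i, 0 ≤ 1 / P i := fun i => one_div_nonneg.2 (one_pos.trans (hP i)).le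
  have h := le_iSup₂ (f := fun (Q : Set (Fin n → ℝ)) (_ : IsCube Q) =>
    (∫⁻ x in Q, maxFn (fun i => Q.indicator (dualWeight P w i)) x ^ p
        * ENNReal.ofReal (v x)) ^ (1 / p)
      * (∏ i, wMeasure (dualWeight P w i) Q ^ (1 / P i))⁻¹) R hR
  change _ ≤ sawyerConst P p v w at h
  rw [setLIntegral_mul_ofReal_eq_wMeasure hv _ hR.measurableSet, ← div_eq_mul_inv,
    ENNReal.div_le_iff_le_mul
      (Or.inl (prod_wMeasure_rpow_ne_zero (fun i => aemeasurable_dualWeight (hw i))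
        (fun i => dualWeight_pos (hpos i)) hr hR))
      (Or.inl (prod_wMeasure_rpow_ne_top hloc hr hR)), one_div,
    ENNReal.rpow_inv_le_iff hp0, ENNReal.mul_rpow_of_nonneg _ _ hp0.le,
    ← ENNReal.prod_rpow_of_nonneg hp0.le] at h
  refine h.trans (le_of_eq ?_)
  congr 1
  refine Finset.prod_congr rfl fun i _ => ?_
  rw [← ENNReal.rpow_mul]
  congr 1
  ring

/-- Necessity of the testing condition. -/
theorem MaxBound.sawyerConst_le (hP : ∀ i, 1 < P i) (hp0 : 0 < p)
    {v : (Fin n → ℝ) → ℝ} (hw : ∀ i, AEMeasurable (w i) volume) (hpos : ∀ i, ∀ᵐ x, 0 < w i x)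
    (hloc : ∀ i, LocallyIntegrable (dualWeight P w i) volume) {C : ℝ≥0∞}
    (hC : MaxBound P p v w C) : sawyerConst P p v w ≤ C := by
  refine iSup₂_le fun Q hQ => ?_
  have hP0 : ∀ i, 0 < P i := fun i => one_pos.trans (hP i)
  have hr : ∀ i, 0 ≤ 1 / P i := fun i => one_div_nonneg.2 (hP0 i).le
  have hfin : ∀ i, wMeasure (dualWeight P w i) Q ≠ ∞ := fun i => hQ.wMeasure_ne_top (hloc i)
  rw [← div_eq_mul_inv, ENNReal.div_le_iff_le_mul
      (Or.inl (prod_wMeasure_rpow_ne_zero (fun i => aemeasurable_dualWeight (hw i))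
        (fun i => dualWeight_pos (hpos i)) hr hQ))
      (Or.inl (prod_wMeasure_rpow_ne_top hloc hr hQ))]
  -- Test functions `f i = χ_Q`, whose norms are `σᵢ(Q) ^ (1 / P i)`.
  have h := hC (fun _ => Q.indicator fun _ => 1) fun i =>
    memLp_indicator_const _ hQ.measurableSet 1 (Or.inr (hfin i))
  have hnorm : ∀ i, eLpNorm (Q.indicator fun _ => (1 : ℝ)) (ENNReal.ofReal (P i))
      (wMeasure (dualWeight P w i)) = wMeasure (dualWeight P w i) Q ^ (1 / P i) := fun i => by
    rw [eLpNorm_indicator_const hQ.measurableSet (by simp [hP0 i]) ENNReal.ofReal_ne_top,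
      ENNReal.toReal_ofReal (hP0 i).le]
    simp
  have hfun : (fun (i : Fin m) (y : Fin n → ℝ) =>
      Q.indicator (fun _ => (1 : ℝ)) y * dualWeight P w i y)
      = fun i => Q.indicator (dualWeight P w i) := by
    funext i y
    by_cases hy : y ∈ Q <;> simp [hy]
  simp only [hnorm, hfun] at h
  exact (ENNReal.rpow_le_rpow (setLIntegral_le_lintegral _ _) (by positivity)).trans h

/-- The two-weight inequality with an explicit constant. -/
theorem maxBound_of_rhCond (hP : ∀ i, 1 < P i) (hp0 : 0 < p) (hp : ∑ i, p / P i = 1)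
    {v : (Fin n → ℝ) → ℝ} (hv : AEMeasurable v volume)
    (hw : ∀ i, AEMeasurable (w i) volume) (hpos : ∀ i, ∀ᵐ x, 0 < w i x)
    (hloc : ∀ i, LocallyIntegrable (dualWeight P w i) volume) (hRH : RHCond P p w) :
    MaxBound P p v w ((6 ^ (n * m) * (2 ^ n) ^ (1 / p) * ∏ i, ENNReal.ofReal (P i / (P i - 1)))
      * (sawyerConst P p v w * rhConst P p w ^ (1 / p))) := by
  intro f hf
  have hP0 : ∀ i, 0 < P i := fun i => one_pos.trans (hP i)
  have hp' : 0 ≤ 1 / p := one_div_nonneg.2 hp0.le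
  have hC : ∀ R, IsCube R → ∏ i, wMeasure (dualWeight P w i) R ^ (p / P i)
      ≤ rhConst P p w * ∫⁻ x in R, ∏ i, ENNReal.ofReal (dualWeight P w i x) ^ (p / P i) := by
    intro R hR
    simpa only [setLIntegral_ofReal_eq_wMeasure _ hR] using
      hRH.rhBound_rhConst hP hp0 hp hw hloc R hR
  have h := lintegral_maxFn_mul_rpow_le hP hp0 hp (V := wMeasure v)
    (fun i => aemeasurable_dualWeight (hw i)) (fun i => dualWeight_pos (hpos i)) hloc
    (fun R hR => setLIntegral_maxFn_indicator_rpow_le_sawyerConst hP hp0 hv hw hpos hloc hR)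
    hC hf
  have hnorm : ∀ i, (∫⁻ x, ‖f i x‖ₑ ^ P i ∂wMeasure (dualWeight P w i)) ^ (p / P i)
      = eLpNorm (f i) (ENNReal.ofReal (P i)) (wMeasure (dualWeight P w i)) ^ p := fun i => by
    rw [eLpNorm_eq_lintegral_rpow_enorm_toReal (by simp [hP0 i]) ENNReal.ofReal_ne_top,
      ENNReal.toReal_ofReal (hP0 i).le, ← ENNReal.rpow_mul]
    congr 1
    ring
  simp only [hnorm, ← ENNReal.mul_rpow_of_nonneg _ _ hp0.le] at h
  rw [ENNReal.prod_rpow_of_nonneg hp0.le, Finset.prod_mul_distrib] at h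
  rw [lintegral_mul_ofReal_eq_wMeasure hv]
  -- Taking `p`-th roots: `6 ^ n` comes from the volume comparison for each function, `2 ^ n` counts
  -- the grids, and the product collects the Doob constants.
  refine (ENNReal.rpow_le_rpow h hp').trans (le_of_eq ?_)
  have hinv : ∀ a : ℝ≥0∞, (a ^ p) ^ (1 / p) = a := fun a => by
    rw [one_div, ENNReal.rpow_rpow_inv hp0.ne']
  simp only [ENNReal.mul_rpow_of_nonneg _ _ hp', hinv]
  ring

end Weights

theorem MaxBound.mono {P : Fin m → ℝ} {p : ℝ} {v : (Fin n → ℝ) → ℝ}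
    {w : Fin m → (Fin n → ℝ) → ℝ} {C D : ℝ≥0∞} (h : MaxBound P p v w C) (hCD : C ≤ D) :
    MaxBound P p v w D :=
  fun f hf => (h f hf).trans (mul_le_mul_left hCD _)

end Main

end MultiSawyer

theorem theorem3p2 (n m : ℕ) (hn : 1 ≤ n) (hm : 1 ≤ m)
    (P : Fin m → ℝ) (hP : ∀ i, 1 < P i) (p : ℝ) (hp : 1 / p = ∑ i, 1 / P i) :
    ∃ c : ℝ, 0 < c ∧
      ∀ (v : (Fin n → ℝ) → ℝ) (w : Fin m → (Fin n → ℝ) → ℝ),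
        AEMeasurable v volume → (∀ᵐ x, 0 ≤ v x) →
        (∀ i, AEMeasurable (w i) volume) → (∀ i, ∀ᵐ x, 0 < w i x) →
        (∀ i, LocallyIntegrable (MultiSawyer.dualWeight P w i) volume) →
        MultiSawyer.RHCond P p w →
        ((∃ C : ℝ, 0 < C ∧ MultiSawyer.MaxBound P p v w (ENNReal.ofReal C)) ↔
            MultiSawyer.SawyerCond P p v w) ∧
        MultiSawyer.sawyerConst P p v w
            ≤ ENNReal.ofReal c * MultiSawyer.maxNorm P p v w ∧
        MultiSawyer.maxNorm P p v w
            ≤ ENNReal.ofReal c * (MultiSawyer.sawyerConst P p v w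
                * MultiSawyer.rhConst P p w ^ (1 / p)) := by
  -- Since `m ≥ 1` the sum is positive, which excludes `p = 0` under the convention `1 / 0 = 0`.
  have hsum : 0 < ∑ i, 1 / P i :=
    Finset.sum_pos (fun i _ => one_div_pos.2 (one_pos.trans (hP i))) ⟨⟨0, hm⟩, Finset.mem_univ _⟩
  have hp0 : 0 < p := one_div_pos.1 (hp ▸ hsum)
  have hp1 : ∑ i, p / P i = 1 := by
    simp only [div_eq_mul_one_div p, ← Finset.mul_sum]
    rw [← hp, mul_one_div_cancel hp0.ne']
  set c₀ : ℝ≥0∞ :=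
    6 ^ (n * m) * (2 ^ n) ^ (1 / p) * ∏ i, ENNReal.ofReal (P i / (P i - 1)) with hc₀
  have hc₀t : c₀ ≠ ∞ := by
    refine ENNReal.mul_ne_top (ENNReal.mul_ne_top (ENNReal.pow_ne_top (by simp))
      (ENNReal.rpow_ne_top_of_nonneg (by positivity) (ENNReal.pow_ne_top (by simp)))) ?_
    exact (ENNReal.prod_lt_top fun i _ => ENNReal.ofReal_lt_top).ne
  have hc : ENNReal.ofReal (1 + c₀.toReal) = 1 + c₀ := by
    rw [ENNReal.ofReal_add one_pos.le ENNReal.toReal_nonneg, ENNReal.ofReal_one,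
      ENNReal.ofReal_toReal hc₀t]
  -- Necessity holds with constant one, sufficiency with `c₀`; the sum serves both.
  refine ⟨1 + c₀.toReal, by positivity, fun v w hv _ hw hpos hloc hRH => ?_⟩
  rw [hc]
  have hnec : ∀ C, MultiSawyer.MaxBound P p v w C → MultiSawyer.sawyerConst P p v w ≤ C :=
    fun C hC => hC.sawyerConst_le hP hp0 hw hpos hloc
  have hsuf : MultiSawyer.MaxBound P p v w ((1 + c₀) * (MultiSawyer.sawyerConst P p v w
      * MultiSawyer.rhConst P p w ^ (1 / p))) :=
    (MultiSawyer.maxBound_of_rhCond hP hp0 hp1 hv hw hpos hloc hRH).mono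
      (mul_le_mul_left le_add_self _)
  refine ⟨⟨?_, fun hS => ?_⟩, ?_, sInf_le hsuf⟩
  · rintro ⟨C, -, hC⟩
    exact (hnec _ hC).trans_lt ENNReal.ofReal_lt_top
  · have hfin : (1 + c₀) * (MultiSawyer.sawyerConst P p v w
        * MultiSawyer.rhConst P p w ^ (1 / p)) ≠ ∞ :=
      ENNReal.mul_ne_top (ENNReal.add_ne_top.2 ⟨ENNReal.one_ne_top, hc₀t⟩)
        (ENNReal.mul_ne_top (LT.lt.ne hS) (ENNReal.rpow_ne_top_of_nonneg (by positivity)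
          (MultiSawyer.rhConst_lt_top hRH).ne))
    -- Adding one keeps the constant positive even if the bound is zero.
    refine ⟨_ + 1, by positivity, hsuf.mono ((ENNReal.le_ofReal_iff_toReal_le hfin
      (by positivity)).2 (le_add_of_nonneg_right one_pos.le))⟩
  · exact (le_sInf hnec).trans (le_mul_of_one_le_left zero_le le_self_add)
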